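/- Let $\mathrm{Pol}=\mathbb Z[x_1,x_2,\dots]$ and let $\mathrm{Pol}^+\subset\mathrm{Pol}$ be the ideal of polynomials with no constant term. For $i\ge 1$ put $R_i f=f(x_1,\dots,x_{i-1},0,x_i,x_{i+1},\dots)$ and let $T_i=\frac{R_{i+1}-R_i}{x_i}$ be the quasisymmetric divided differences. Let $Z=\mathrm{id}+R_1+R_1^2+\cdots:\mathrm{Pol}^+\to\mathrm{Pol}^+$ (a locally finite sum), and let $Zx_i:\mathrm{Pol}\to\mathrm{Pol}$ be multiplication by $x_i$ followed by $Z$. An indexed forest $F$ is a sequence $(\tau_k)_{k\ge1}$ of rooted plane binary trees (each node is a leaf or an internal node with a left and a right child), all but finitely many of them trivial (a single leaf); $\varnothing$ is the forest all of whose trees are trivial. The leaves of $F$ are numbered $1,2,3,\dots$ from left to right. For an internal node $v$ let $\rho_F(v)$ be the number of the leaf reached from $v$ by going down left edges, let $c_i(F)=\#\{v:\rho_F(v)=i\}$, and let $\mathrm{LTer}(F)=\{i: c_i(F)\ne0,\ c_{i+1}(F)=0\}$ be the left terminal set. For $i\in\mathrm{LTer}(F)$ there is exactly one internal node $v$ with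 $\rho_F(v)=i$ whose two children are both leaves, and $F/i$ denotes the forest obtained from $F$ by deleting $v$ (so that it becomes a leaf). Let $\mathrm{Trim}(F)$ be the set of sequences $(i_1,\dots,i_k)$, $k\ge0$, with $(((F/i_k)/i_{k-1})/\cdots)/i_1=\varnothing$, where every trimming is at an element of the left terminal set of the forest being trimmed. **Theorem.** The operators $Zx_i$ are creation operators for the $T_i$: each $Zx_i$ is linear and sends homogeneous polynomials of degree $d$ to homogeneous polynomials of degree $d+1$, and for every $f\in\mathrm{Pol}^+$ only finitely many $T_if$ are nonzero and $$\sum_{i\ge1}Zx_i\,T_i f=f .$$ Moreover there is exactly one family $(P_F)$ of homogeneous polynomials in $\mathrm{Pol}$, indexed by the indexed forests $F$, such that $P_\varnothing=1$ and, for all $F$ and all $i\ge1$, $$T_iP_F=\begin{cases}P_{F/i}&\text{if } i\in\mathrm{LTer}(F),\\0&\text{otherwise.}\end{cases}$$ For every $F$ the set $\mathrm{Trim}(F)$ is finite, and these forest polynomials have the monomial-positive expansion $$P_F=\sum_{(i_1,\dots,i_k)\in\mathrm{Trim}(F)}Zx_{i_k}\cdots Zx_{i_1}(1),$$ in which every summand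 is a polynomial with nonnegative coefficients. -/

import Mathlib

noncomputable section

namespace ForestPoly

open MvPolynomial

/-! Indices are shifted by one: the natural number `i` stands for the positive integer `i + 1`, for
variables, operators and leaves alike.  Thus `X i` is the variable `x_{i+1}`. -/

/-- `ℤ[x₁, x₂, …]`. -/
abbrev Poly : Type := MvPolynomial ℕ ℤ

/-- The polynomials with no constant term. -/
def polyPos : Submodule ℤ Poly where
  carrier := {f | constantCoeff f = 0}
  add_mem' := by
    intro a b ha hb
    simp only [Set.mem_ofPred_eq] at ha hb ⊢
    rw [map_add, ha, hb, add_zero]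
  zero_mem' := by simp
  smul_mem' := by
    intro c f hf
    simp only [Set.mem_ofPred_eq] at hf ⊢
    rw [zsmul_eq_mul, map_mul, hf, mul_zero]

/-- The substitution `f ↦ f(x₁, …, x_{i-1}, 0, x_i, x_{i+1}, …)`. -/
def rope (i : ℕ) : Poly →ₐ[ℤ] Poly :=
  aeval fun j => if j < i then X j else if j = i then 0 else X (j - 1)

/-- The quotient `(R_{i+1} f - R_i f) / x_i`, as a linear operator.  The division is exact, see
`X_mul_tope`. -/
def tope (i : ℕ) : Poly →ₗ[ℤ] Poly where
  toFun f := (rope (i + 1) f - rope i f).divMonomial (Finsupp.single i 1)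
  map_add' f g := by
    rw [map_add, map_add, ← add_divMonomial]
    congr 1
    ring
  map_smul' c f := by
    ext m
    rw [map_smul, map_smul, ← smul_sub, coeff_divMonomial, coeff_smul, RingHom.id_apply, coeff_smul,
      coeff_divMonomial]

theorem X_dvd_rope_sub (i : ℕ) (f : Poly) : (X i : Poly) ∣ rope (i + 1) f - rope i f := by
  induction f using MvPolynomial.induction_on with
  | C a => simp [rope]
  | add p q hp hq =>
    have h : rope (i + 1) (p + q) - rope i (p + q)
        = (rope (i + 1) p - rope i p) + (rope (i + 1) q - rope i q) := by
      rw [map_add, map_add]; ring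
    rw [h]
    exact dvd_add hp hq
  | mul_X p j hp =>
    have h : rope (i + 1) (p * X j) - rope i (p * X j)
        = (rope (i + 1) p - rope i p) * rope (i + 1) (X j)
          + rope i p * (rope (i + 1) (X j) - rope i (X j)) := by
      rw [map_mul, map_mul]; ring
    rw [h]
    refine dvd_add (hp.mul_right _) (Dvd.dvd.mul_left ?_ _)
    simp only [rope, aeval_X]
    rcases lt_trichotomy j i with hj | hj | hj
    · simp [hj, hj.trans (Nat.lt_succ_self i)]
    · subst hj; simp
    · rcases (Nat.succ_le_of_lt hj).eq_or_lt with h1 | h1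
      · subst h1; simp
      · have e1 : ¬ j < i + 1 := by omega
        have e2 : ¬ j = i + 1 := by omega
        have e3 : ¬ j < i := by omega
        have e4 : ¬ j = i := by omega
        simp [e1, e2, e3, e4]

/-- The operator `tope i` is the exact quotient: `x_i T_i f = R_{i+1} f - R_i f`. -/
theorem X_mul_tope (i : ℕ) (f : Poly) : X i * tope i f = rope (i + 1) f - rope i f := by
  have h := divMonomial_add_modMonomial_single (rope (i + 1) f - rope i f) i
  rw [X_dvd_iff_modMonomial_eq_zero.1 (X_dvd_rope_sub i f), add_zero] at h
  exact h

/-- The first substitution `f ↦ f(0, x₁, x₂, …)`, restricted to the polynomials with no constant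
term. -/
def ropeOnePos : polyPos →ₗ[ℤ] polyPos :=
  ((rope 0).toLinearMap.comp polyPos.subtype).codRestrict polyPos (by
    rintro ⟨f, hf⟩
    change constantCoeff (rope 0 f) = 0
    have hc : (constantCoeff (σ := ℕ) (R := ℤ)).comp (rope 0).toRingHom = constantCoeff := by
      apply MvPolynomial.ringHom_ext
      · intro r; simp [rope]
      · intro j
        by_cases hj : j = 0 <;> simp [rope, hj]
    have h2 := congrArg (fun g : Poly →+* ℤ => g f) hc
    exact h2.trans hf)

theorem rope_zero_pow (k : ℕ) (f : Poly) :
    (⇑(rope 0))^[k] f = aeval (fun j => if j < k then (0 : Poly) else X (j - k)) f := by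
  induction k generalizing f with
  | zero => simp
  | succ k ih =>
    rw [Function.iterate_succ_apply, ih, ← AlgHom.comp_apply]
    congr 1
    apply MvPolynomial.algHom_ext
    intro j
    rcases j with _ | j
    · simp [rope]
    · simp [rope]

theorem coe_ropeOnePos_pow (k : ℕ) (f : polyPos) :
    (((ropeOnePos ^ k) f : polyPos) : Poly) = (⇑(rope 0))^[k] (f : Poly) := by
  induction k with
  | zero => simp
  | succ k ih =>
    rw [pow_succ', Function.iterate_succ_apply', ← ih]
    rfl

/-- On a polynomial with no constant term only finitely many powers of `R₁` are nonzero. -/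
theorem finite_support_ropeOnePos (f : polyPos) :
    (Function.support fun k : ℕ => (ropeOnePos ^ k) f).Finite := by
  obtain ⟨N, hN⟩ : ∃ N, ∀ j ∈ (f : Poly).vars, j < N :=
    ⟨(f : Poly).vars.sup id + 1, fun j hj =>
      Nat.lt_succ_of_le (Finset.le_sup (f := id) hj)⟩
  refine (Set.finite_lt_nat N).subset fun k hk => ?_
  by_contra hlt
  apply hk
  apply Subtype.ext
  have hle : N ≤ k := not_lt.1 hlt
  rw [coe_ropeOnePos_pow, rope_zero_pow]
  have h0 : aeval (fun j => if j < k then (0 : Poly) else X (j - k)) (f : Poly)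
      = aeval (fun _ => (0 : Poly)) (f : Poly) := by
    apply eval₂Hom_congr' rfl _ rfl
    intro j hj _
    exact if_pos ((hN j hj).trans_le hle)
  rw [h0]
  have hf : constantCoeff (f : Poly) = 0 := f.2
  rw [aeval_zero', hf, map_zero]
  rfl

/-- The operator `Z = id + R₁ + R₁² + ⋯` on the polynomials with no constant term. -/
def zope : polyPos →ₗ[ℤ] polyPos where
  toFun f := ∑ᶠ k : ℕ, (ropeOnePos ^ k) f
  map_add' f g := by
    rw [← finsum_add_distrib (finite_support_ropeOnePos f) (finite_support_ropeOnePos g)]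
    simp only [map_add]
  map_smul' c f := by
    simp only [map_smul, RingHom.id_apply]
    rw [smul_finsum]

/-- Multiplication by the variable `x_i`, as a map into the polynomials with no constant term. -/
def mulX (i : ℕ) : Poly →ₗ[ℤ] polyPos :=
  (LinearMap.mulLeft ℤ (X i : Poly)).codRestrict polyPos (by
    intro f
    change constantCoeff (X i * f) = 0
    simp)

/-- The operator `Z x_i`: multiply by `x_i`, then apply `Z`. -/
def zx (i : ℕ) : Poly →ₗ[ℤ] Poly :=
  polyPos.subtype ∘ₗ zope ∘ₗ mulX i

/-- `Y` is a family of creation operators for the operators `T`: each `Y i` has degree one, and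
`∑ i, Y i (T i f) = f`, a sum with finitely many nonzero terms, if `f` has no constant term. -/
structure IsCreationFamily (T Y : ℕ → Poly →ₗ[ℤ] Poly) : Prop where
  isHomogeneous : ∀ (i d : ℕ) (f : Poly), f.IsHomogeneous d → (Y i f).IsHomogeneous (d + 1)
  finite : ∀ f ∈ polyPos, {i | T i f ≠ 0}.Finite
  sum_eq : ∀ f ∈ polyPos, ∑ᶠ i, Y i (T i f) = f

/-- A rooted plane binary tree: `nil` is a leaf, `node () l r` an internal node with left child
`l` and right child `r`. -/
abbrev PlaneTree : Type := BinaryTree Unit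

/-- An indexed forest: a sequence of plane binary trees, all but finitely many of them trivial. -/
@[ext]
structure IndexedForest : Type where
  tree : ℕ → PlaneTree
  finite : {k | tree k ≠ BinaryTree.nil}.Finite

namespace IndexedForest

/-- The forest all of whose trees are trivial. -/
def empty : IndexedForest where
  tree _ := BinaryTree.nil
  finite := by simp

/-- The leaves of a forest are numbered from left to right; this is the number of the leftmost
leaf of the `k`-th tree. -/
def firstLeaf (F : IndexedForest) (k : ℕ) : ℕ := ∑ j ∈ Finset.range k, (F.tree j).numLeaves

/-- In a tree whose leaves are numbered `s, s + 1, …` from left to right, the labels of all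
internal nodes `v`, where the label of `v` is the number of the leaf reached from `v` by going
down left edges. -/
def nodeLabels : ℕ → PlaneTree → Multiset ℕ
  | _, BinaryTree.nil => 0
  | s, BinaryTree.node _ l r =>
      s ::ₘ (nodeLabels s l + nodeLabels (s + l.numLeaves) r)

/-- The code of a forest: the number of its internal nodes with label `i`. -/
def code (F : IndexedForest) (i : ℕ) : ℕ :=
  ∑ k ∈ F.finite.toFinset, (nodeLabels (F.firstLeaf k) (F.tree k)).count i

/-- The left terminal set. -/
def lter (F : IndexedForest) : Set ℕ := {i | F.code i ≠ 0 ∧ F.code (i + 1) = 0}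

/-- In a tree whose leaves are numbered `s, s + 1, …`, delete the terminal node with leaves
`i` and `i + 1` (if there is one), making it a leaf. -/
def trimTree (i : ℕ) : ℕ → PlaneTree → PlaneTree
  | _, BinaryTree.nil => BinaryTree.nil
  | s, BinaryTree.node _ BinaryTree.nil BinaryTree.nil =>
      if s = i then BinaryTree.nil
      else BinaryTree.node () BinaryTree.nil BinaryTree.nil
  | s, BinaryTree.node _ l r =>
      BinaryTree.node () (trimTree i s l) (trimTree i (s + l.numLeaves) r)

/-- The trimmed forest `F/i`: delete the terminal node with leaves `i` and `i + 1`.  It is used for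
`i ∈ F.lter` only, where there is exactly one such node. -/
def trim (F : IndexedForest) (i : ℕ) : IndexedForest where
  tree k := trimTree i (F.firstLeaf k) (F.tree k)
  finite := F.finite.subset fun k hk h => hk (by
    simp only [h, trimTree])

/-- `L = [i₁, …, i_k]` is a trimming sequence of `F`: it is possible to trim `F` at `i_k`, then
at `i_{k-1}`, and so on down to `i₁`, and the result is the empty forest. -/
inductive IsTrimming : List ℕ → IndexedForest → Prop
  | nil : IsTrimming [] empty
  | snoc {L : List ℕ} {i : ℕ} {F : IndexedForest} :
      i ∈ F.lter → IsTrimming L (F.trim i) → IsTrimming (L ++ [i]) F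

end IndexedForest

/-- The set of trimming sequences of `F`. -/
def trimSeqs (F : IndexedForest) : Set (List ℕ) := {L | IndexedForest.IsTrimming L F}

/-- `Z x_{i_k} ⋯ Z x_{i₁} (1)` for `L = [i₁, …, i_k]`: the operator of index `i₁` acts first. -/
def zxWord (L : List ℕ) : Poly := L.foldl (fun f i => zx i f) 1

/-- `P` is a family of forest polynomials: homogeneous polynomials with `P_∅ = 1`, where
`T_i P_F = P_{F/i}` if `i` is in the left terminal set of `F` and `T_i P_F = 0` otherwise. -/
structure IsForestFamily (P : IndexedForest → Poly) : Prop where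
  isHomogeneous : ∀ F, ∃ d, (P F).IsHomogeneous d
  empty : P IndexedForest.empty = 1
  tope_of_mem : ∀ F, ∀ i ∈ F.lter, tope i (P F) = P (F.trim i)
  tope_of_notMem : ∀ F, ∀ i ∉ F.lter, tope i (P F) = 0

end ForestPoly

end

noncomputable section

namespace ForestPoly

open MvPolynomial

/-! Since `x_i T_i = R_{i+1} - R_i`, the sum of all `x_i T_i f` telescopes to `f - R_1 f`, and `Z`
inverts `id - R_1` on polynomials without constant term; this is the creation identity
`sum_zx_tope`.

For existence, let `P_F` be the sum over trimming sequences. Splitting off the last letter gives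
`P_F = ∑ Zx_i P_{F/i}` over the left terminal set. That `T_m` recovers the `m`-th summand's input is
an integrability statement (`tope_sum_zx`): it holds for any finitely supported family `g` with `T_i
g_j = T_j g_{i+1}` for `j < i`. For `g_i = P_{F/i}` (zero off the left terminal set) this follows by
induction on size from the commutation of trimmings, `(F/j)/i` against `(F/(i+1))/j`. It is checked
on codes only: trimming at `i` lowers `c_i` by one and deletes the zero entry `c_{i+1}`
(`trim_spec`), and the set of trimming sequences depends on the code alone.

For uniqueness, the creation identity rebuilds `P_F` from the smaller `P_{F/i}`. -/

/-! ### Relations among the substitutions and divided differences -/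

theorem rope_X (i j : ℕ) :
    rope i (X j) = if j < i then X j else if j = i then 0 else X (j - 1) := by
  simp [rope]

theorem rope_X_of_lt {i j : ℕ} (h : j < i) : rope i (X j) = X j := by simp [rope_X, h]

theorem rope_X_self (i : ℕ) : rope i (X i) = 0 := by simp [rope_X]

theorem rope_X_of_gt {i j : ℕ} (h : i < j) : rope i (X j) = X (j - 1) := by
  simp [rope_X, h.not_gt, h.ne']

/-- `rope i f = f` for all sufficiently large `i`. -/
theorem exists_rope_eq_self (f : Poly) : ∃ N, ∀ i, N ≤ i → rope i f = f := by
  induction f using MvPolynomial.induction_on with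
  | C a => exact ⟨0, fun i _ => by simp [rope]⟩
  | add p q hp hq =>
    obtain ⟨M, hM⟩ := hp
    obtain ⟨N, hN⟩ := hq
    exact ⟨max M N, fun i hi => by
      rw [map_add, hM i (le_of_max_le_left hi), hN i (le_of_max_le_right hi)]⟩
  | mul_X p j hp =>
    obtain ⟨M, hM⟩ := hp
    exact ⟨max M (j + 1), fun i hi => by
      rw [map_mul, hM i (le_of_max_le_left hi), rope_X_of_lt (le_of_max_le_right hi)]⟩

theorem X_mul_cancel {i : ℕ} {f g : Poly} (h : X i * f = X i * g) : f = g :=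
  mul_left_cancel₀ (MvPolynomial.X_ne_zero i) h

theorem tope_eq_zero {i : ℕ} {f : Poly} (h : rope (i + 1) f = rope i f) : tope i f = 0 := by
  apply X_mul_cancel (i := i)
  rw [X_mul_tope, h, sub_self, mul_zero]

/-- `tope i f = 0` for all sufficiently large `i`. -/
theorem exists_tope_eq_zero (f : Poly) : ∃ N, ∀ i, N ≤ i → tope i f = 0 := by
  obtain ⟨N, hN⟩ := exists_rope_eq_self f
  exact ⟨N, fun i hi => tope_eq_zero (by rw [hN i hi, hN (i + 1) (by omega)])⟩

theorem tope_C (i : ℕ) (c : ℤ) : tope i (C c) = 0 := tope_eq_zero (by simp [rope])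

theorem rope_rope_zero (i : ℕ) (f : Poly) : rope i (rope 0 f) = rope 0 (rope (i + 1) f) := by
  rw [← AlgHom.comp_apply, ← AlgHom.comp_apply]
  congr 1
  apply MvPolynomial.algHom_ext
  intro j
  rw [AlgHom.comp_apply, AlgHom.comp_apply]
  rcases j with _ | j
  · simp [rope_X]
  · rcases lt_trichotomy j i with h | h | h
    · simp [rope_X, h]
    · subst h
      simp [rope_X]
    · have h1 : j ≠ 0 := by omega
      simp [rope_X, h.not_gt, h.ne', h1]

theorem tope_rope_zero (j : ℕ) (f : Poly) : tope j (rope 0 f) = rope 0 (tope (j + 1) f) := by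
  apply X_mul_cancel (i := j)
  have h : (X j : Poly) = rope 0 (X (j + 1)) := by simp [rope_X]
  rw [X_mul_tope, h, ← map_mul, X_mul_tope, map_sub, rope_rope_zero, rope_rope_zero]

/-! ### `Z` as the inverse of `id - R_1`, and the creation identity -/

theorem zope_eq_add (f : polyPos) : zope f = f + zope (ropeOnePos f) := by
  have hf := finite_support_ropeOnePos f
  obtain ⟨M, hM⟩ := hf.bddAbove
  have h0 : ∀ k, M < k → (ropeOnePos ^ k) f = 0 := fun k hk => by
    by_contra h
    exact absurd (hM h) (not_le.2 hk)
  -- One term more than in `e2`, so that the two ranges agree once `k = 0` is split off.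
  have e1 : zope f = ∑ k ∈ Finset.range (M + 2), (ropeOnePos ^ k) f := by
    apply finsum_eq_sum_of_support_subset
    intro k hk
    have := hM hk
    simp only [Finset.coe_range, Set.mem_Iio]
    omega
  have e2 : zope (ropeOnePos f) = ∑ k ∈ Finset.range (M + 1), (ropeOnePos ^ k) (ropeOnePos f) := by
    apply finsum_eq_sum_of_support_subset
    intro k hk
    simp only [Finset.coe_range, Set.mem_Iio]
    by_contra h
    apply hk
    change (ropeOnePos ^ k) (ropeOnePos f) = 0
    have : (ropeOnePos ^ k) (ropeOnePos f) = (ropeOnePos ^ (k + 1)) f := by rw [pow_succ]; rfl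
    rw [this]
    exact h0 _ (by omega)
  rw [e1, e2, Finset.sum_range_succ', add_comm]
  congr 1

theorem zope_sub (f : polyPos) : zope (f - ropeOnePos f) = f := by
  rw [map_sub, zope_eq_add f]
  abel

/-- `Z` commutes with `R_1`, so `id - R_1` also undoes `Z` from the left. -/
theorem zx_sub_rope_zero (i : ℕ) (g : Poly) : zx i g - rope 0 (zx i g) = X i * g := by
  have h1 := zope_eq_add (mulX i g)
  have h2 : zope (ropeOnePos (mulX i g)) = ropeOnePos (zope (mulX i g)) := by
    change (∑ᶠ k : ℕ, (ropeOnePos ^ k) (ropeOnePos (mulX i g))) =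
      ropeOnePos (∑ᶠ k : ℕ, (ropeOnePos ^ k) (mulX i g))
    have := (ropeOnePos.toAddMonoidHom).map_finsum (finite_support_ropeOnePos (mulX i g))
    refine Eq.trans (finsum_congr fun k => ?_) this.symm
    change (ropeOnePos ^ k * ropeOnePos) (mulX i g) = (ropeOnePos * ropeOnePos ^ k) (mulX i g)
    rw [← pow_succ, ← pow_succ']
  rw [h2] at h1
  have h3 := congrArg (Subtype.val) h1
  change zx i g = X i * g + rope 0 (zx i g) at h3
  rw [sub_eq_iff_eq_add]
  exact h3

/-- `Z` is pulled out of the sum; the rest telescopes to `f - R_1 f`. -/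
theorem sum_zx_tope {f : Poly} (hf : f ∈ polyPos) : ∑ᶠ i, zx i (tope i f) = f := by
  obtain ⟨N, hN⟩ := exists_rope_eq_self f
  have e1 : ∑ᶠ i, zx i (tope i f) = ∑ i ∈ Finset.range N, zx i (tope i f) := by
    apply finsum_eq_sum_of_support_subset
    intro k hk
    simp only [Finset.coe_range, Set.mem_Iio]
    by_contra h
    apply hk
    change zx k (tope k f) = 0
    rw [tope_eq_zero (by rw [hN k (by omega), hN (k + 1) (by omega)]), map_zero]
  have e2 : ∑ i ∈ Finset.range N, mulX i (tope i f) =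
      (⟨f, hf⟩ : polyPos) - ropeOnePos ⟨f, hf⟩ := by
    apply Subtype.ext
    rw [AddSubmonoidClass.coe_finsetSum]
    change ∑ i ∈ Finset.range N, X i * tope i f = f - rope 0 f
    simp only [X_mul_tope]
    rw [Finset.sum_range_sub (fun i => rope i f), hN N le_rfl]
  have e3 := congrArg Subtype.val (zope_sub ⟨f, hf⟩)
  rw [← e2, map_sum, AddSubmonoidClass.coe_finsetSum] at e3
  rw [e1]
  exact e3

theorem isHomogeneous_rope {d : ℕ} {f : Poly} (i : ℕ) (hf : f.IsHomogeneous d) :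
    (rope i f).IsHomogeneous d := by
  have := hf.aeval (n := 1) (fun j => if j < i then (X j : Poly) else if j = i then 0 else X (j - 1))
    (fun j => by
      split_ifs
      · exact isHomogeneous_X _ _
      · exact isHomogeneous_zero _ _ _
      · exact isHomogeneous_X _ _)
  rwa [one_mul] at this

/-- Reduces homogeneity and positivity of `zx` to those of powers of `rope 0`. -/
theorem zx_eq_finsum (i : ℕ) (f : Poly) :
    ∃ M, zx i f = ∑ k ∈ Finset.range M, (⇑(rope 0))^[k] (X i * f) := by
  obtain ⟨M, hM⟩ := (finite_support_ropeOnePos (mulX i f)).bddAbove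
  refine ⟨M + 1, ?_⟩
  have e1 : zope (mulX i f) = ∑ k ∈ Finset.range (M + 1), (ropeOnePos ^ k) (mulX i f) := by
    apply finsum_eq_sum_of_support_subset
    intro k hk
    have := hM hk
    simp only [Finset.coe_range, Set.mem_Iio]
    omega
  change ((zope (mulX i f) : polyPos) : Poly) = _
  rw [e1, AddSubmonoidClass.coe_finsetSum]
  exact Finset.sum_congr rfl fun k _ => coe_ropeOnePos_pow k _

theorem isHomogeneous_zx {d : ℕ} {f : Poly} (i : ℕ) (hf : f.IsHomogeneous d) :
    (zx i f).IsHomogeneous (d + 1) := by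
  obtain ⟨M, hM⟩ := zx_eq_finsum i f
  rw [hM]
  refine IsHomogeneous.sum _ _ _ fun k hk => ?_
  clear hk
  have h : (X i * f : Poly).IsHomogeneous (d + 1) := by
    rw [add_comm]
    exact (isHomogeneous_X _ _).mul hf
  induction k with
  | zero => exact h
  | succ k ih =>
    rw [Function.iterate_succ_apply']
    exact isHomogeneous_rope 0 ih

theorem isCreationFamily_zx : IsCreationFamily tope zx where
  isHomogeneous i _ _ hf := isHomogeneous_zx i hf
  finite f _ := by
    obtain ⟨N, hN⟩ := exists_tope_eq_zero f
    refine (Set.finite_lt_nat N).subset fun k hk => ?_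
    by_contra h
    exact hk (hN k (not_lt.1 h))
  sum_eq _ hf := sum_zx_tope hf

/-! ### Nonnegativity and degree of the summands -/

/-- The polynomials with nonnegative coefficients. -/
def nonnegPoly : Subsemiring Poly where
  carrier := {f | ∀ m, 0 ≤ coeff m f}
  zero_mem' m := by simp
  one_mem' m := by
    classical
    rw [coeff_one]
    split_ifs <;> simp
  add_mem' hf hg m := by
    rw [coeff_add]
    exact add_nonneg (hf m) (hg m)
  mul_mem' hf hg m := by
    classical
    rw [coeff_mul]
    exact Finset.sum_nonneg fun x _ => mul_nonneg (hf _) (hg _)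

theorem X_mem_nonnegPoly (i : ℕ) : (X i : Poly) ∈ nonnegPoly := fun m => by
  classical
  rw [coeff_X]
  split_ifs <;> simp

theorem rope_mem_nonnegPoly (i : ℕ) {f : Poly} (hf : f ∈ nonnegPoly) : rope i f ∈ nonnegPoly := by
  rw [rope, aeval_def, eval₂_eq]
  refine sum_mem fun m _ => mul_mem ?_ (prod_mem fun j _ => pow_mem ?_ _)
  · obtain ⟨n, hn⟩ := Int.eq_ofNat_of_zero_le (hf m)
    rw [hn, map_natCast]
    exact natCast_mem _ n
  · split_ifs
    · exact X_mem_nonnegPoly _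
    · exact zero_mem _
    · exact X_mem_nonnegPoly _

theorem zx_mem_nonnegPoly (i : ℕ) {f : Poly} (hf : f ∈ nonnegPoly) : zx i f ∈ nonnegPoly := by
  obtain ⟨M, hM⟩ := zx_eq_finsum i f
  rw [hM]
  refine sum_mem fun k hk => ?_
  clear hk
  induction k with
  | zero => exact mul_mem (X_mem_nonnegPoly i) hf
  | succ k ih =>
    rw [Function.iterate_succ_apply']
    exact rope_mem_nonnegPoly 0 ih

theorem zxWord_append_singleton (L : List ℕ) (i : ℕ) : zxWord (L ++ [i]) = zx i (zxWord L) := by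
  simp [zxWord]

theorem zxWord_mem_nonnegPoly (L : List ℕ) : zxWord L ∈ nonnegPoly := by
  induction L using List.reverseRecOn with
  | nil => exact one_mem _
  | append_singleton L i ih =>
    rw [zxWord_append_singleton]
    exact zx_mem_nonnegPoly i ih

theorem isHomogeneous_zxWord (L : List ℕ) : (zxWord L).IsHomogeneous L.length := by
  induction L using List.reverseRecOn with
  | nil => exact isHomogeneous_one _ _
  | append_singleton L i ih =>
    rw [zxWord_append_singleton, List.length_append]
    exact isHomogeneous_zx i ih

/-! ### Integrating a compatible family -/

section Integration

variable {g : ℕ → Poly}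

/-- Compatibility makes two telescopes. For `i < m` a term is `x_m x_i T_m g_i = x_m (R_{i+1} - R_i)
g_{m+1}`; for `i > m + 1` it is `x_m (R_i - R_{i-1}) g_m`. The terms `i = m, m + 1` join them, each
losing the part whose variable is set to zero. -/
theorem sum_rope_sub (hg : ∀ i j, j < i → tope i (g j) = tope j (g (i + 1))) (m k : ℕ) :
    ∑ i ∈ Finset.range (m + 2 + k), (rope (m + 1) (X i * g i) - rope m (X i * g i)) =
      X m * (rope (m + 1 + k) (g m) - rope 0 (g (m + 1))) := by
  induction k with
  | zero =>
    have h : ∀ n, n ≤ m → ∑ i ∈ Finset.range n, (rope (m + 1) (X i * g i) - rope m (X i * g i)) =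
        X m * (rope n (g (m + 1)) - rope 0 (g (m + 1))) := by
      intro n hn
      induction n with
      | zero => simp
      | succ n ih =>
        rw [Finset.sum_range_succ, ih (by omega), map_mul, map_mul,
          rope_X_of_lt (by omega : n < m), rope_X_of_lt (by omega : n < m + 1), ← mul_sub,
          ← X_mul_tope, hg m n (by omega), mul_left_comm, X_mul_tope]
        ring
    rw [add_zero, add_zero, Finset.sum_range_succ, Finset.sum_range_succ, h m le_rfl]
    simp only [map_mul]
    rw [rope_X_self, rope_X_self, rope_X_of_lt (Nat.lt_succ_self m),
      rope_X_of_gt (Nat.lt_succ_self m), Nat.succ_sub_one]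
    ring
  | succ k ih =>
    rw [← add_assoc, Finset.sum_range_succ, ih, map_mul, map_mul, rope_X_of_gt (by omega),
      rope_X_of_gt (by omega), ← mul_sub, ← X_mul_tope,
      show m + 2 + k = m + 1 + k + 1 by omega, Nat.add_sub_cancel, ← hg _ _ (by omega),
      mul_left_comm, X_mul_tope, ← add_assoc]
    ring

theorem tope_sum_X_mul (hg : ∀ i j, j < i → tope i (g j) = tope j (g (i + 1))) {N : ℕ}
    (hN : ∀ i, N ≤ i → g i = 0) (m : ℕ) :
    tope m (∑ i ∈ Finset.range N, X i * g i) = g m - rope 0 (g (m + 1)) := by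
  obtain ⟨M, hM⟩ := exists_rope_eq_self (g m)
  have h : ∑ i ∈ Finset.range N, X i * g i =
      -- `N` makes the range cover every nonzero `g i`; `M` makes the top substitution fix `g m`.
      ∑ i ∈ Finset.range (m + 2 + (M + N)), X i * g i := by
    apply Finset.sum_subset
    · intro i
      simp only [Finset.mem_range]
      omega
    · intro i _ hi
      rw [hN i (by simpa using hi), mul_zero]
  apply X_mul_cancel (i := m)
  rw [X_mul_tope, h, map_sum, map_sum, ← Finset.sum_sub_distrib, sum_rope_sub hg,
    hM _ (by omega)]

/-- A compatible family `g` is the family of divided differences of `∑ i, Z x_i g_i`. -/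
theorem tope_sum_zx (hg : ∀ i j, j < i → tope i (g j) = tope j (g (i + 1))) {N : ℕ}
    (hN : ∀ i, N ≤ i → g i = 0) (m : ℕ) :
    tope m (∑ i ∈ Finset.range N, zx i (g i)) = g m := by
  set f := ∑ i ∈ Finset.range N, zx i (g i) with hf
  have h1 : f - rope 0 f = ∑ i ∈ Finset.range N, X i * g i := by
    rw [hf, map_sum, ← Finset.sum_sub_distrib]
    exact Finset.sum_congr rfl fun i _ => zx_sub_rope_zero i (g i)
  -- The defects `T_j f - g_j` are each `R_1` of the next one and vanish for large `j`, hence all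
  -- vanish.
  have h2 : ∀ j, tope j f - g j = rope 0 (tope (j + 1) f - g (j + 1)) := by
    intro j
    have := tope_sum_X_mul hg hN j
    rw [← h1, map_sub, tope_rope_zero] at this
    rw [map_sub]
    linear_combination this
  obtain ⟨M, hM⟩ := exists_tope_eq_zero f
  have h3 : ∀ k j, M + N ≤ j + k → tope j f - g j = 0 := by
    intro k
    induction k with
    | zero =>
      intro j hj
      rw [hM j (by omega), hN j (by omega), sub_zero]
    | succ k ih =>
      intro j hj
      rw [h2, ih (j + 1) (by omega), map_zero]
  exact sub_eq_zero.1 (h3 (M + N) m (by omega))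

end Integration

/-! ### Codes of forests under trimming -/

namespace IndexedForest

theorem mem_nodeLabels_bounds {s x : ℕ} {t : PlaneTree} (h : x ∈ nodeLabels s t) :
    s ≤ x ∧ x + 1 < s + t.numLeaves := by
  induction t generalizing s with
  | nil => simp [nodeLabels] at h
  | node a l r ihl ihr =>
    have hl := l.numLeaves_pos
    have hr := r.numLeaves_pos
    simp only [nodeLabels, Multiset.mem_cons, Multiset.mem_add] at h
    simp only [BinaryTree.numLeaves]
    rcases h with rfl | h | h
    · omega
    · have := ihl h
      omega
    · have := ihr h
      omega

theorem count_nodeLabels_eq_zero {s x : ℕ} {t : PlaneTree}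
    (h : x < s ∨ s + t.numLeaves ≤ x + 1) : (nodeLabels s t).count x = 0 := by
  rw [Multiset.count_eq_zero]
  intro hx
  have := mem_nodeLabels_bounds hx
  omega

theorem count_nodeLabels_node (s x : ℕ) (a : Unit) (l r : PlaneTree) :
    (nodeLabels s (BinaryTree.node a l r)).count x = (if x = s then 1 else 0) +
      (nodeLabels s l).count x + (nodeLabels (s + l.numLeaves) r).count x := by
  rw [nodeLabels, Multiset.count_cons, Multiset.count_add]
  ring

theorem count_nodeLabels_succ (s x : ℕ) (t : PlaneTree) :
    (nodeLabels (s + 1) t).count (x + 1) = (nodeLabels s t).count x := by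
  induction t generalizing s with
  | nil => simp [nodeLabels]
  | node a l r ihl ihr =>
    rw [count_nodeLabels_node, count_nodeLabels_node, ihl, add_right_comm s 1, ihr]
    simp

theorem count_nodeLabels_self_ne_zero (s : ℕ) (a : Unit) (l r : PlaneTree) :
    (nodeLabels s (BinaryTree.node a l r)).count s ≠ 0 := by
  rw [count_nodeLabels_node, if_pos rfl]
  omega

theorem eq_nil_of_numLeaves_le_one {t : PlaneTree} (h : t.numLeaves ≤ 1) : t = BinaryTree.nil := by
  cases t with
  | nil => rfl
  | node a l r =>
    have hl := l.numLeaves_pos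
    have hr := r.numLeaves_pos
    simp only [BinaryTree.numLeaves] at h
    omega

theorem count_nodeLabels_self_of_one_lt {t : PlaneTree} (s : ℕ) (h : 1 < t.numLeaves) :
    (nodeLabels s t).count s ≠ 0 := by
  cases t with
  | nil => simp at h
  | node a l r => exact count_nodeLabels_self_ne_zero s a l r

theorem trimTree_node {i s : ℕ} {a : Unit} {l r : PlaneTree}
    (h : ¬ (l = BinaryTree.nil ∧ r = BinaryTree.nil)) :
    trimTree i s (BinaryTree.node a l r) =
      BinaryTree.node () (trimTree i s l) (trimTree i (s + l.numLeaves) r) := by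
  cases l with
  | nil =>
    cases r with
    | nil => exact absurd ⟨rfl, rfl⟩ h
    | node b l' r' => conv_lhs => rw [trimTree.eq_def]
  | node b l' r' => rw [trimTree]; simp

/-- Leaves `i` and `i + 1` do not both lie in the tree. -/
theorem trimTree_eq_self {i s : ℕ} {t : PlaneTree} (h : i < s ∨ s + t.numLeaves ≤ i + 1) :
    trimTree i s t = t := by
  induction t generalizing s with
  | nil => rfl
  | node a l r ihl ihr =>
    by_cases hlr : l = BinaryTree.nil ∧ r = BinaryTree.nil
    · obtain ⟨rfl, rfl⟩ := hlr
      have : s ≠ i := by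
        simp only [BinaryTree.numLeaves] at h
        omega
      simp [trimTree, this]
    · have hl := l.numLeaves_pos
      have hr := r.numLeaves_pos
      simp only [BinaryTree.numLeaves] at h
      rw [trimTree_node hlr, ihl (by omega), ihr (by omega)]

/-- The effect of trimming a tree at an element of its left terminal set. -/
theorem trimTree_spec {i s : ℕ} {t : PlaneTree} (h0 : (nodeLabels s t).count i ≠ 0)
    (h1 : (nodeLabels s t).count (i + 1) = 0) :
    (trimTree i s t).numLeaves + 1 = t.numLeaves ∧
    (∀ x < i, (nodeLabels s (trimTree i s t)).count x = (nodeLabels s t).count x) ∧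
    (nodeLabels s (trimTree i s t)).count i + 1 = (nodeLabels s t).count i ∧
    ∀ x, i < x → (nodeLabels s (trimTree i s t)).count x = (nodeLabels s t).count (x + 1) := by
  induction t generalizing s with
  | nil => simp [nodeLabels] at h0
  | node a l r ihl ihr =>
    by_cases hlr : l = BinaryTree.nil ∧ r = BinaryTree.nil
    · obtain ⟨rfl, rfl⟩ := hlr
      have hs : s = i := by
        simp only [nodeLabels, add_zero, ne_eq, Multiset.count_eq_zero, not_not,
          Multiset.mem_cons, Multiset.notMem_zero, or_false] at h0
        exact h0.symm
      subst hs
      refine ⟨by simp [trimTree], fun x hx => ?_, by simp [trimTree, nodeLabels], fun x hx => ?_⟩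
      · simp [trimTree, nodeLabels, hx.ne]
      · have : x + 1 ≠ s := by omega
        simp [trimTree, nodeLabels, this]
    · have hl := l.numLeaves_pos
      have hr := r.numLeaves_pos
      rw [trimTree_node hlr]
      rw [count_nodeLabels_node] at h0 h1
      rw [if_neg] at h1
      swap
      · intro his
        rw [if_neg (by omega), count_nodeLabels_eq_zero (by omega),
          count_nodeLabels_eq_zero (by omega)] at h0
        exact h0 rfl
      -- Leaf `i + 1` lies in `l`, is the first leaf of `r`, or lies further right. In the middle
      -- case only the root can have label `i`, so `l` is a leaf, and a nontrivial `r` would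
      -- contribute the label `i + 1`.
      rcases lt_trichotomy (i + 1) (s + l.numLeaves) with hi | hi | hi
      · have hli : (nodeLabels s l).count i ≠ 0 := by
          by_cases his : i = s
          · subst his
            exact count_nodeLabels_self_of_one_lt i (by omega)
          · rw [if_neg his, count_nodeLabels_eq_zero (t := r) (by omega)] at h0
            omega
        have hsi := (mem_nodeLabels_bounds (Multiset.count_ne_zero.1 hli)).1
        obtain ⟨e0, e1, e2, e3⟩ := ihl hli (by omega)
        rw [trimTree_eq_self (t := r) (Or.inl (by omega))]
        -- `l` lost a leaf, so the labels of `r` drop by one.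
        have hsh : ∀ x, (nodeLabels (s + (trimTree i s l).numLeaves) r).count x =
            (nodeLabels (s + l.numLeaves) r).count (x + 1) := by
          intro x
          rw [← e0, ← add_assoc, count_nodeLabels_succ]
        have hz : ∀ x, x ≤ i + 1 → (nodeLabels (s + l.numLeaves) r).count x = 0 := fun x hx =>
          count_nodeLabels_eq_zero (by omega)
        simp only [count_nodeLabels_node, hsh, BinaryTree.numLeaves]
        refine ⟨by omega, fun x hx => ?_, ?_, fun x hx => ?_⟩
        · rw [e1 x hx, hz x (by omega), hz (x + 1) (by omega)]
        · rw [hz _ le_rfl, hz i (by omega)]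
          omega
        · rw [e3 x hx, if_neg (by omega), if_neg (by omega)]
      · rw [count_nodeLabels_eq_zero (t := l) (by omega),
          count_nodeLabels_eq_zero (t := r) (by omega)] at h0
        have his : i = s := by
          by_contra h
          rw [if_neg h] at h0
          exact h0 rfl
        subst his
        refine absurd ⟨eq_nil_of_numLeaves_le_one (by omega), ?_⟩ hlr
        apply eq_nil_of_numLeaves_le_one
        by_contra h
        have := count_nodeLabels_self_of_one_lt (t := r) (i + l.numLeaves) (by omega)
        rw [← hi] at this h1
        omega
      · have hri : (nodeLabels (s + l.numLeaves) r).count i ≠ 0 := by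
          rw [if_neg (by omega), count_nodeLabels_eq_zero (t := l) (by omega)] at h0
          omega
        obtain ⟨e0, e1, e2, e3⟩ := ihr hri (by omega)
        rw [trimTree_eq_self (t := l) (Or.inr (by omega))]
        simp only [count_nodeLabels_node, BinaryTree.numLeaves]
        refine ⟨by omega, fun x hx => ?_, by omega, fun x hx => ?_⟩
        · rw [e1 x hx]
        · rw [e3 x hx, if_neg (by omega), if_neg (by omega),
            count_nodeLabels_eq_zero (t := l) (x := x) (by omega),
            count_nodeLabels_eq_zero (t := l) (by omega)]

theorem code_eq_sum (F : IndexedForest) {S : Finset ℕ}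
    (hS : ∀ k, F.tree k ≠ BinaryTree.nil → k ∈ S) (i : ℕ) :
    F.code i = ∑ k ∈ S, (nodeLabels (F.firstLeaf k) (F.tree k)).count i := by
  apply Finset.sum_subset
  · intro k hk
    exact hS k (by simpa using hk)
  · intro k _ hk
    have : F.tree k = BinaryTree.nil := by simpa using hk
    rw [this, nodeLabels, Multiset.count_zero]

theorem firstLeaf_succ (F : IndexedForest) (k : ℕ) :
    F.firstLeaf (k + 1) = F.firstLeaf k + (F.tree k).numLeaves := Finset.sum_range_succ _ _

theorem firstLeaf_mono (F : IndexedForest) : Monotone F.firstLeaf :=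
  monotone_nat_of_le_succ fun k => by
    rw [firstLeaf_succ]
    omega

theorem firstLeaf_add_numLeaves_le (F : IndexedForest) {j k : ℕ} (h : j < k) :
    F.firstLeaf j + (F.tree j).numLeaves ≤ F.firstLeaf k := by
  rw [← firstLeaf_succ]
  exact F.firstLeaf_mono h

/-- The number of internal nodes of a forest. -/
def size (F : IndexedForest) : ℕ := ∑ k ∈ F.finite.toFinset, (F.tree k).numNodes

theorem size_eq_sum (F : IndexedForest) {S : Finset ℕ}
    (hS : ∀ k, F.tree k ≠ BinaryTree.nil → k ∈ S) :
    F.size = ∑ k ∈ S, (F.tree k).numNodes := by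
  apply Finset.sum_subset
  · intro k hk
    exact hS k (by simpa using hk)
  · intro k _ hk
    have : F.tree k = BinaryTree.nil := by simpa using hk
    rw [this, BinaryTree.numNodes]

/-- Labels of different trees occupy disjoint ranges, so only one tree changes; those to its right
are renumbered down by one. -/
theorem trim_spec {F : IndexedForest} {i : ℕ} (hi : i ∈ F.lter) :
    (F.trim i).size + 1 = F.size ∧ (∀ x < i, (F.trim i).code x = F.code x) ∧
    (F.trim i).code i + 1 = F.code i ∧ ∀ x, i < x → (F.trim i).code x = F.code (x + 1) := by
  obtain ⟨h0, h1⟩ := hi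
  set S := F.finite.toFinset with hS
  have hF : ∀ k, F.tree k ≠ BinaryTree.nil → k ∈ S := fun k hk => by simpa [hS] using hk
  have hT : ∀ k, (F.trim i).tree k ≠ BinaryTree.nil → k ∈ S := fun k hk => by
    apply hF
    intro h
    apply hk
    change trimTree i _ (F.tree k) = _
    rw [h, trimTree]
  obtain ⟨k, hkS, hk⟩ : ∃ k ∈ S, (nodeLabels (F.firstLeaf k) (F.tree k)).count i ≠ 0 :=
    Finset.exists_ne_zero_of_sum_ne_zero h0
  have hk1 : (nodeLabels (F.firstLeaf k) (F.tree k)).count (i + 1) = 0 :=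
    Finset.sum_eq_zero_iff.1 h1 k hkS
  have hb := mem_nodeLabels_bounds (Multiset.count_ne_zero.1 hk)
  obtain ⟨e0, e1, e2, e3⟩ := trimTree_spec hk hk1
  have htree : ∀ j, j ≠ k → (F.trim i).tree j = F.tree j := by
    intro j hj
    apply trimTree_eq_self
    rcases lt_or_gt_of_ne hj with h | h
    · have := F.firstLeaf_add_numLeaves_le h
      omega
    · have := F.firstLeaf_add_numLeaves_le h
      omega
  have htk : (F.trim i).tree k = trimTree i (F.firstLeaf k) (F.tree k) := rfl
  have hle : ∀ j, j ≤ k → (F.trim i).firstLeaf j = F.firstLeaf j := by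
    intro j hj
    refine Finset.sum_congr rfl fun l hl => ?_
    rw [htree l (by have := Finset.mem_range.1 hl; omega)]
  have hgt : ∀ j, k < j → (F.trim i).firstLeaf j + 1 = F.firstLeaf j := by
    intro j hj
    induction j, hj using Nat.le_induction with
    | base =>
      rw [firstLeaf_succ, firstLeaf_succ, hle k le_rfl, htk]
      omega
    | succ j hj ih =>
      rw [firstLeaf_succ, firstLeaf_succ, htree j (by omega)]
      omega
  have hcgt : ∀ j, k < j → ∀ x, (nodeLabels ((F.trim i).firstLeaf j) (F.tree j)).count x =
      (nodeLabels (F.firstLeaf j) (F.tree j)).count (x + 1) := by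
    intro j hj x
    rw [← hgt j hj, count_nodeLabels_succ]
  have hzlt : ∀ j, j < k → ∀ x, i ≤ x → (nodeLabels (F.firstLeaf j) (F.tree j)).count x = 0 := by
    intro j hj x hx
    have := F.firstLeaf_add_numLeaves_le hj
    exact count_nodeLabels_eq_zero (by omega)
  have hzgt : ∀ j, k < j → ∀ x, x ≤ i + 1 →
      (nodeLabels (F.firstLeaf j) (F.tree j)).count x = 0 := by
    intro j hj x hx
    have := F.firstLeaf_add_numLeaves_le hj
    exact count_nodeLabels_eq_zero (by omega)
  simp only [code_eq_sum _ hF, code_eq_sum _ hT, size_eq_sum _ hF, size_eq_sum _ hT]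
  refine ⟨?_, fun x hx => Finset.sum_congr rfl fun j _ => ?_, ?_,
    fun x hx => Finset.sum_congr rfl fun j _ => ?_⟩
  · rw [← Finset.add_sum_erase _ _ hkS, ← Finset.add_sum_erase S _ hkS, htk,
      Finset.sum_congr rfl fun j hj => by rw [htree j (Finset.ne_of_mem_erase hj)]]
    rw [BinaryTree.numLeaves_eq_numNodes_succ, BinaryTree.numLeaves_eq_numNodes_succ] at e0
    omega
  · rcases lt_trichotomy j k with h | rfl | h
    · rw [htree j h.ne, hle j h.le]
    · rw [htk, hle j le_rfl, e1 x hx]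
    · rw [htree j h.ne', hcgt j h, hzgt j h _ (by omega), hzgt j h _ (by omega)]
  · rw [← Finset.add_sum_erase _ _ hkS, ← Finset.add_sum_erase S _ hkS, htk, hle k le_rfl,
      ← e2, add_right_comm]
    congr 1
    refine Finset.sum_congr rfl fun j hj => ?_
    rcases lt_or_gt_of_ne (Finset.ne_of_mem_erase hj) with h | h
    · rw [htree j h.ne, hle j h.le]
    · rw [htree j h.ne', hcgt j h, hzgt j h _ (by omega), hzgt j h _ (by omega)]
  · rcases lt_trichotomy j k with h | rfl | h
    · rw [htree j h.ne, hle j h.le, hzlt j h _ (by omega), hzlt j h _ (by omega)]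
    · rw [htk, hle j le_rfl, e3 x hx]
    · rw [htree j h.ne', hcgt j h]

theorem code_empty (i : ℕ) : empty.code i = 0 :=
  Finset.sum_eq_zero fun k _ => by simp [empty, nodeLabels]

theorem lter_empty : empty.lter = ∅ :=
  Set.eq_empty_of_forall_notMem fun i hi => hi.1 (code_empty i)

/-- A nontrivial tree has its first leaf as a label. -/
theorem eq_empty_of_code {F : IndexedForest} (h : ∀ i, F.code i = 0) : F = empty := by
  ext k : 2
  by_contra hk
  have h1 := Finset.sum_eq_zero_iff.1 (h (F.firstLeaf k)) k (by simpa [empty] using hk)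
  have h2 : ¬ 1 < (F.tree k).numLeaves := fun h => count_nodeLabels_self_of_one_lt _ h h1
  exact hk (eq_nil_of_numLeaves_le_one (by omega))

theorem finite_support_code (F : IndexedForest) : (Function.support F.code).Finite := by
  refine (F.finite.toFinset.biUnion fun k =>
    (nodeLabels (F.firstLeaf k) (F.tree k)).toFinset).finite_toSet.subset fun i hi => ?_
  obtain ⟨k, hkS, hk⟩ := Finset.exists_ne_zero_of_sum_ne_zero hi
  simp only [Finset.coe_biUnion, Set.mem_iUnion]
  exact ⟨k, hkS, by simpa using Multiset.count_ne_zero.1 hk⟩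

theorem finite_lter (F : IndexedForest) : F.lter.Finite :=
  F.finite_support_code.subset fun _ hi => hi.1

/-- Otherwise a nonzero code entry would force all later entries to be nonzero, against finite
support. -/
theorem lter_nonempty {F : IndexedForest} (h : F ≠ empty) : F.lter.Nonempty := by
  by_contra hne
  have h1 : ∃ i, F.code i ≠ 0 := by
    by_contra! h0
    exact h (eq_empty_of_code h0)
  obtain ⟨i, hi⟩ := h1
  have h2 : ∀ n, F.code (i + n) ≠ 0 := by
    intro n
    induction n with
    | zero => exact hi
    | succ n ih =>
      intro h0
      exact hne ⟨i + n, ih, h0⟩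
  refine Set.infinite_of_injective_forall_mem (f := fun n => i + n) ?_ h2 F.finite_support_code
  exact fun a b hab => Nat.add_left_cancel hab

theorem code_trim_congr {F G : IndexedForest} (h : F.code = G.code) {i : ℕ} (hi : i ∈ F.lter) :
    (F.trim i).code = (G.trim i).code := by
  have hi' : i ∈ G.lter := by rwa [lter, ← h]
  obtain ⟨-, a1, a2, a3⟩ := trim_spec hi
  obtain ⟨-, b1, b2, b3⟩ := trim_spec hi'
  funext x
  rcases lt_trichotomy x i with hx | rfl | hx
  · rw [a1 x hx, b1 x hx, h]
  · rw [← h] at b2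
    omega
  · rw [a3 x hx, b3 x hx, h]

theorem mem_lter_trim_of_lt {F : IndexedForest} {i j : ℕ} (hj : j ∈ F.lter) (hij : j < i) :
    i ∈ (F.trim j).lter ↔ i + 1 ∈ F.lter := by
  obtain ⟨-, a1, a2, a3⟩ := trim_spec hj
  simp only [lter, Set.mem_ofPred_eq, a3 i hij, a3 (i + 1) (by omega)]

theorem mem_lter_trim_of_gt {F : IndexedForest} {i j : ℕ} (hi : i + 1 ∈ F.lter) (hij : j < i) :
    j ∈ (F.trim (i + 1)).lter ↔ j ∈ F.lter := by
  obtain ⟨-, a1, a2, a3⟩ := trim_spec hi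
  simp only [lter, Set.mem_ofPred_eq, a1 j (by omega), a1 (j + 1) (by omega)]

/-- Trimming at `j` moves the entries beyond `j + 1` one place left, so the later site is called `i
+ 1` before it and `i` after. -/
theorem code_trim_trim {F : IndexedForest} {i j : ℕ} (hj : j ∈ F.lter) (hi : i + 1 ∈ F.lter)
    (hij : j < i) : ((F.trim j).trim i).code = ((F.trim (i + 1)).trim j).code := by
  obtain ⟨-, a1, a2, a3⟩ := trim_spec hj
  obtain ⟨-, b1, b2, b3⟩ := trim_spec hi
  obtain ⟨-, c1, c2, c3⟩ := trim_spec ((mem_lter_trim_of_lt hj hij).2 hi)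
  obtain ⟨-, d1, d2, d3⟩ := trim_spec ((mem_lter_trim_of_gt hi hij).2 hj)
  funext x
  rcases lt_trichotomy x j with hx | rfl | hx
  · rw [c1 x (by omega), d1 x hx, a1 x hx, b1 x (by omega)]
  · have := c1 x hij
    have := b1 x (by omega)
    omega
  · rw [d3 x hx]
    rcases lt_trichotomy x i with hx' | rfl | hx'
    · rw [c1 x hx', a3 x hx, b1 _ (by omega)]
    · have := a3 x hx
      omega
    · rw [c3 x hx', b3 _ (by omega), a3 _ (by omega)]

/-- Lets equality of codes stand in for equality of forests, so the code need not be shown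
injective. -/
theorem IsTrimming.congr_code {L : List ℕ} {F G : IndexedForest} (hF : IsTrimming L F)
    (h : F.code = G.code) : IsTrimming L G := by
  induction hF generalizing G with
  | nil =>
    rw [eq_empty_of_code (F := G) fun i => by rw [← h, code_empty]]
    exact .nil
  | snoc hi _ ih =>
    refine .snoc ?_ (ih (code_trim_congr h hi))
    rwa [lter, ← h]

theorem IsTrimming.length_eq {L : List ℕ} {F : IndexedForest} (hF : IsTrimming L F) :
    L.length = F.size := by
  induction hF with
  | nil => exact (Finset.sum_eq_zero fun k _ => by simp [empty]).symm
  | snoc hi _ ih =>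
    rw [← (trim_spec hi).1, ← ih, List.length_append, List.length_singleton]

end IndexedForest

/-! ### Trimming sequences -/

open IndexedForest

theorem trimSeqs_congr {F G : IndexedForest} (h : F.code = G.code) : trimSeqs F = trimSeqs G :=
  Set.ext fun _ => ⟨fun hL => IsTrimming.congr_code hL h, fun hL => IsTrimming.congr_code hL h.symm⟩

theorem isTrimming_iff {L : List ℕ} {F : IndexedForest} : IsTrimming L F ↔
    (L = [] ∧ F = IndexedForest.empty) ∨
      ∃ i ∈ F.lter, ∃ L', IsTrimming L' (F.trim i) ∧ L' ++ [i] = L := by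
  constructor
  · rintro (_ | ⟨hi, h⟩)
    · exact Or.inl ⟨rfl, rfl⟩
    · exact Or.inr ⟨_, hi, _, h, rfl⟩
  · rintro (⟨rfl, rfl⟩ | ⟨i, hi, L', h, rfl⟩)
    · exact .nil
    · exact .snoc hi h

theorem trimSeqs_empty : trimSeqs IndexedForest.empty = {[]} := by
  ext L
  rw [trimSeqs, Set.mem_ofPred_eq, isTrimming_iff, lter_empty]
  simp

theorem trimSeqs_eq_biUnion {F : IndexedForest} (h : F ≠ IndexedForest.empty) :
    trimSeqs F = ⋃ i ∈ F.lter, (fun L => L ++ [i]) '' trimSeqs (F.trim i) := by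
  ext L
  rw [trimSeqs, Set.mem_ofPred_eq, isTrimming_iff]
  simp [h, trimSeqs]

theorem finite_trimSeqs (F : IndexedForest) : (trimSeqs F).Finite := by
  induction hn : F.size using Nat.strong_induction_on generalizing F with
  | _ n ih =>
    by_cases h : F = IndexedForest.empty
    · rw [h, trimSeqs_empty]
      exact Set.finite_singleton _
    · rw [trimSeqs_eq_biUnion h]
      refine F.finite_lter.biUnion fun i hi => (ih _ ?_ _ rfl).image _
      have := (trim_spec hi).1
      omega

/-! ### Existence of the forest polynomials -/

/-- The forest polynomial of `F`. -/
def forestPoly (F : IndexedForest) : Poly := ∑ᶠ L ∈ trimSeqs F, zxWord L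

theorem forestPoly_empty : forestPoly IndexedForest.empty = 1 := by
  rw [forestPoly, trimSeqs_empty, finsum_mem_singleton]
  rfl

theorem forestPoly_congr {F G : IndexedForest} (h : F.code = G.code) :
    forestPoly F = forestPoly G := by
  rw [forestPoly, forestPoly, trimSeqs_congr h]

/-- Group the trimming sequences by last letter, the operator that acts last. -/
theorem forestPoly_eq_finsum {F : IndexedForest} (h : F ≠ IndexedForest.empty) :
    forestPoly F = ∑ᶠ i ∈ F.lter, zx i (forestPoly (F.trim i)) := by
  rw [forestPoly, trimSeqs_eq_biUnion h, finsum_mem_biUnion _ F.finite_lter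
    (fun i _ => (finite_trimSeqs _).image _)]
  · refine finsum_mem_congr rfl fun i _ => ?_
    rw [finsum_mem_image fun L _ L' _ h => List.append_cancel_right h]
    simp only [zxWord_append_singleton]
    exact ((zx i).toAddMonoidHom.map_finsum_mem _ (finite_trimSeqs _)).symm
  · intro i _ j _ hij
    rw [Function.onFun, Set.disjoint_left]
    rintro _ ⟨L, _, rfl⟩ ⟨L', _, h⟩
    exact hij (List.append_inj_right' h rfl |> List.singleton_inj.1).symm

theorem isHomogeneous_forestPoly (F : IndexedForest) : (forestPoly F).IsHomogeneous F.size := by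
  rw [forestPoly, finsum_mem_eq_finite_toFinset_sum _ (finite_trimSeqs F)]
  refine IsHomogeneous.sum _ _ _ fun L hL => ?_
  rw [Set.Finite.mem_toFinset] at hL
  rw [← IsTrimming.length_eq hL]
  exact isHomogeneous_zxWord L

open Classical in
theorem tope_forestPoly (F : IndexedForest) (m : ℕ) :
    tope m (forestPoly F) = if m ∈ F.lter then forestPoly (F.trim m) else 0 := by
  induction hn : F.size using Nat.strong_induction_on generalizing F m with
  | _ n ih =>
    by_cases h : F = IndexedForest.empty
    · rw [h, lter_empty, forestPoly_empty, if_neg (Set.notMem_empty m)]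
      exact tope_C m 1
    obtain ⟨N, hN⟩ := F.finite_lter.bddAbove
    have hsum : forestPoly F = ∑ i ∈ Finset.range (N + 1),
        zx i (if i ∈ F.lter then forestPoly (F.trim i) else 0) := by
      rw [forestPoly_eq_finsum h, finsum_mem_def]
      refine (finsum_eq_sum_of_support_subset (s := Finset.range (N + 1)) _ ?_).trans
        (Finset.sum_congr rfl fun i _ => ?_)
      · intro i hi
        have := hN (Set.mem_of_indicator_ne_zero hi)
        simp only [Finset.coe_range, Set.mem_Iio]
        omega
      · by_cases hi : i ∈ F.lter <;> simp [hi]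
    rw [hsum]
    refine tope_sum_zx (g := fun i => if i ∈ F.lter then forestPoly (F.trim i) else 0)
      (fun i j hij => ?_) (N := N + 1) (fun i hi => if_neg fun hi' => ?_) m
    · have hlt : ∀ k ∈ F.lter, (F.trim k).size < n := fun k hk => by
        have := (trim_spec hk).1
        omega
      by_cases hj : j ∈ F.lter
      · rw [if_pos hj, ih _ (hlt j hj) _ _ rfl]
        by_cases hi : i + 1 ∈ F.lter
        · rw [if_pos hi, ih _ (hlt _ hi) _ _ rfl, if_pos ((mem_lter_trim_of_lt hj hij).2 hi),
            if_pos ((mem_lter_trim_of_gt hi hij).2 hj)]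
          exact forestPoly_congr (code_trim_trim hj hi hij)
        · rw [if_neg hi, if_neg fun h => hi ((mem_lter_trim_of_lt hj hij).1 h), map_zero]
      · rw [if_neg hj, map_zero]
        by_cases hi : i + 1 ∈ F.lter
        · rw [if_pos hi, ih _ (hlt _ hi) _ _ rfl,
            if_neg fun h => hj ((mem_lter_trim_of_gt hi hij).1 h)]
        · rw [if_neg hi, map_zero]
    · have := hN hi'
      omega

theorem isForestFamily_forestPoly : IsForestFamily forestPoly where
  isHomogeneous F := ⟨_, isHomogeneous_forestPoly F⟩
  empty := forestPoly_empty
  tope_of_mem F i hi := by rw [tope_forestPoly, if_pos hi]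
  tope_of_notMem F i hi := by rw [tope_forestPoly, if_neg hi]

/-! ### Uniqueness -/

theorem IsForestFamily.ne_zero {P : IndexedForest → Poly} (hP : IsForestFamily P)
    (F : IndexedForest) : P F ≠ 0 := by
  induction hn : F.size using Nat.strong_induction_on generalizing F with
  | _ n ih =>
    by_cases h : F = IndexedForest.empty
    · rw [h, hP.empty]
      exact one_ne_zero
    · obtain ⟨i, hi⟩ := lter_nonempty h
      intro h0
      have h1 := hP.tope_of_mem F i hi
      rw [h0, map_zero] at h1
      refine ih _ ?_ _ rfl h1.symm
      have := (trim_spec hi).1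
      omega

/-- A homogeneous polynomial with a constant term is constant, so every `T_i` kills it; but some
`T_i P_F = P_{F/i}` is nonzero. -/
theorem IsForestFamily.mem_polyPos {P : IndexedForest → Poly} (hP : IsForestFamily P)
    {F : IndexedForest} (h : F ≠ IndexedForest.empty) : P F ∈ polyPos := by
  obtain ⟨d, hd⟩ := hP.isHomogeneous F
  obtain ⟨i, hi⟩ := lter_nonempty h
  change constantCoeff (P F) = 0
  by_contra hc
  have hd0 : d = 0 := by
    have := hd hc
    simpa using this.symm
  subst hd0
  have h1 : P F = C (coeff 0 (P F)) :=
    totalDegree_eq_zero_iff_eq_C.1 (Nat.le_zero.1 hd.totalDegree_le)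
  apply hP.ne_zero (F.trim i)
  rw [← hP.tope_of_mem F i hi, h1, tope_C]

theorem IsForestFamily.unique {P Q : IndexedForest → Poly} (hP : IsForestFamily P)
    (hQ : IsForestFamily Q) : Q = P := by
  funext F
  induction hn : F.size using Nat.strong_induction_on generalizing F with
  | _ n ih =>
    by_cases h : F = IndexedForest.empty
    · rw [h, hP.empty, hQ.empty]
    · rw [← sum_zx_tope (hP.mem_polyPos h), ← sum_zx_tope (hQ.mem_polyPos h)]
      refine finsum_congr fun i => congrArg (zx i) ?_
      by_cases hi : i ∈ F.lter
      · rw [hP.tope_of_mem F i hi, hQ.tope_of_mem F i hi]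
        refine ih _ ?_ _ rfl
        have := (trim_spec hi).1
        omega
      · rw [hP.tope_of_notMem F i hi, hQ.tope_of_notMem F i hi]

end ForestPoly

end

/-- Indices are shifted by one: the natural number `i` stands for the positive integer `i + 1`. -/
theorem theorem4p1 :
    ForestPoly.IsCreationFamily ForestPoly.tope ForestPoly.zx ∧
    ∃ P : ForestPoly.IndexedForest → ForestPoly.Poly,
      ForestPoly.IsForestFamily P ∧
      (∀ Q : ForestPoly.IndexedForest → ForestPoly.Poly, ForestPoly.IsForestFamily Q → Q = P) ∧
      ∀ F : ForestPoly.IndexedForest,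
        (ForestPoly.trimSeqs F).Finite ∧
        P F = (∑ᶠ L ∈ ForestPoly.trimSeqs F, ForestPoly.zxWord L) ∧
        ∀ L ∈ ForestPoly.trimSeqs F, ∀ m : ℕ →₀ ℕ,
          0 ≤ MvPolynomial.coeff m (ForestPoly.zxWord L) := by
  exact ⟨ForestPoly.isCreationFamily_zx, ForestPoly.forestPoly,
    ForestPoly.isForestFamily_forestPoly,
    fun _ hQ => ForestPoly.isForestFamily_forestPoly.unique hQ,
    fun F => ⟨ForestPoly.finite_trimSeqs F, rfl,
      fun L _ m => ForestPoly.zxWord_mem_nonnegPoly L m⟩⟩
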